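/- Let $\mathcal X$ (candidates) and $\mathcal V$ (voters) be infinite sets. A \emph{profile} is a function $\mathbf P: V\to\mathcal L(X)$, where $V=V(\mathbf P)\subseteq\mathcal V$ and $X=X(\mathbf P)\subseteq\mathcal X$ are finite and $\mathcal L(X)$ is the set of strict linear orders on $X$. For a set $A$ of candidates, $\mathbf P|_A$ is the profile obtained by restricting each voter's order to $X(\mathbf P)\cap A$, and $\mathbf P_{-y}=\mathbf P|_{X(\mathbf P)\setminus\{y\}}$. The \emph{margin} of $x$ over $y$ in $\mathbf P$ is the number of voters ranking $x$ above $y$ minus the number ranking $y$ above $x$. A profile is \emph{uniquely weighted} if for any two distinct ordered pairs $(a,b)\neq(x,y)$ of candidates in $X(\mathbf P)$ with $a\ne b$ and $x\ne y$, the margin of $a$ over $b$ differs from the margin of $x$ over $y$. A \emph{voting method} $F$ assigns to each profile $\mathbf P$ in a nonempty set $\mathrm{dom}(F)$ of profiles a nonempty set $F(\mathbf P)\subseteq X(\mathbf P)$. Consider the following axioms, where all profiles mentioned are assumed to belong to $\mathrm{dom}(F)$. - \textbf{Anonymity}: for all voters $i,j\in\mathcal V$, $F(\mathbf P^{i\leftrightarrows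 j})=F(\mathbf P)$, where $\mathbf P^{i\leftrightarrows j}$ is obtained from $\mathbf P$ by swapping the voters $i$ and $j$ (in the set of voters and in the assignment of ballots). - \textbf{Neutrality}: for all candidates $a,b\in\mathcal X$, $F(\mathbf P_{a\leftrightarrows b})=\pi_{a\leftrightarrows b}[F(\mathbf P)]$, where $\pi_{a\leftrightarrows b}$ is the transposition of $a$ and $b$ and $\mathbf P_{a\leftrightarrows b}$ is obtained from $\mathbf P$ by applying it to the set of candidates and to every ballot. - \textbf{Binary $\gamma$}: for $x,y\in X(\mathbf P)$, if $x\in F(\mathbf P_{-y})$ and $F(\mathbf P|_{\{x,y\}})=\{x\}$, then $x\in F(\mathbf P)$. - \textbf{Quasi-resoluteness}: $|F(\mathbf P)|=1$ for every uniquely weighted profile $\mathbf P$. \textbf{Theorem.} There is no voting method satisfying anonymity, neutrality, binary $\gamma$, and quasi-resoluteness for profiles with up to 4 candidates; that is, there is no voting method $F$ whose domain contains every profile with at least one voter, at least one candidate and at most $4$ candidates and that satisfies these four axioms on its domain. -/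

import Mathlib

namespace Voting

/-- `r` is (the graph of) a strict linear order on the finite set `X`: it relates only elements
of `X`, is irreflexive and transitive, and any two distinct elements of `X` are comparable. -/
structure IsStrictLinearOrderOn {𝒳 : Type*} (X : Finset 𝒳) (r : 𝒳 → 𝒳 → Prop) : Prop where
  support : ∀ x y, r x y → x ∈ X ∧ y ∈ X
  irrefl : ∀ x, ¬ r x x
  trans : ∀ x y z, r x y → r y z → r x z
  total : ∀ x ∈ X, ∀ y ∈ X, x ≠ y → r x y ∨ r y x

/-- A profile: a finite set `voters` of voters, a finite set `cands` of candidates, and for each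
voter in `voters` a strict linear order of `cands`; `ballot i x y` says that voter `i` ranks `x`
above `y`. So that a profile is nothing more than the function from `voters` to strict linear
orders of `cands`, the relation is required to be empty for those `i` that are not voters. -/
@[ext]
structure Profile (𝒳 𝒱 : Type*) where
  voters : Finset 𝒱
  cands : Finset 𝒳
  ballot : 𝒱 → 𝒳 → 𝒳 → Prop
  ballot_linear : ∀ i ∈ voters, IsStrictLinearOrderOn cands (ballot i)
  ballot_empty : ∀ i, i ∉ voters → ∀ x y, ¬ ballot i x y

namespace Profile

variable {𝒳 𝒱 : Type*}

open Classical in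
/-- The margin of `x` over `y`: the number of voters who rank `x` above `y` minus the number of
voters who rank `y` above `x`. -/
noncomputable def margin (P : Profile 𝒳 𝒱) (x y : 𝒳) : ℤ :=
  ((P.voters.filter fun i => P.ballot i x y).card : ℤ) -
    ((P.voters.filter fun i => P.ballot i y x).card : ℤ)

/-- Any two distinct ordered pairs of distinct candidates have different margins. -/
def UniquelyWeighted (P : Profile 𝒳 𝒱) : Prop :=
  ∀ a ∈ P.cands, ∀ b ∈ P.cands, ∀ x ∈ P.cands, ∀ y ∈ P.cands,
    a ≠ b → x ≠ y → (a, b) ≠ (x, y) → P.margin a b ≠ P.margin x y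

/-- The profile `P|_A`: every ballot is restricted to the candidates in `A`. -/
def restrict [DecidableEq 𝒳] (P : Profile 𝒳 𝒱) (A : Finset 𝒳) : Profile 𝒳 𝒱 where
  voters := P.voters
  cands := P.cands ∩ A
  ballot i x y := P.ballot i x y ∧ x ∈ A ∧ y ∈ A
  ballot_linear i hi :=
    { support := fun x y h =>
        ⟨Finset.mem_inter.2 ⟨((P.ballot_linear i hi).support x y h.1).1, h.2.1⟩,
          Finset.mem_inter.2 ⟨((P.ballot_linear i hi).support x y h.1).2, h.2.2⟩⟩
      irrefl := fun x h => (P.ballot_linear i hi).irrefl x h.1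
      trans := fun x y z h₁ h₂ =>
        ⟨(P.ballot_linear i hi).trans x y z h₁.1 h₂.1, h₁.2.1, h₂.2.2⟩
      total := fun x hx y hy hne =>
        ((P.ballot_linear i hi).total x (Finset.mem_inter.1 hx).1 y
          (Finset.mem_inter.1 hy).1 hne).imp
          (fun h => ⟨h, (Finset.mem_inter.1 hx).2, (Finset.mem_inter.1 hy).2⟩)
          (fun h => ⟨h, (Finset.mem_inter.1 hy).2, (Finset.mem_inter.1 hx).2⟩) }
  ballot_empty i hi x y h := P.ballot_empty i hi x y h.1

/-- The profile `P_{-y}`: the restriction of `P` to the candidates other than `y`. -/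
def remove [DecidableEq 𝒳] (P : Profile 𝒳 𝒱) (y : 𝒳) : Profile 𝒳 𝒱 :=
  P.restrict (P.cands.erase y)

/-- The profile obtained from `P` by swapping the voters `i` and `j`. -/
def swapVoters [DecidableEq 𝒱] (P : Profile 𝒳 𝒱) (i j : 𝒱) : Profile 𝒳 𝒱 where
  voters := P.voters.map (Equiv.swap i j).toEmbedding
  cands := P.cands
  ballot k := P.ballot (Equiv.swap i j k)
  ballot_linear k hk := P.ballot_linear _ (by
    rw [Finset.mem_map_equiv, Equiv.symm_swap] at hk
    exact hk)
  ballot_empty k hk := P.ballot_empty _ (by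
    rw [Finset.mem_map_equiv, Equiv.symm_swap] at hk
    exact hk)

/-- The profile obtained from `P` by swapping the candidates `a` and `b` in every ballot. -/
def swapCands [DecidableEq 𝒳] (P : Profile 𝒳 𝒱) (a b : 𝒳) : Profile 𝒳 𝒱 where
  voters := P.voters
  cands := P.cands.map (Equiv.swap a b).toEmbedding
  ballot i x y := P.ballot i (Equiv.swap a b x) (Equiv.swap a b y)
  ballot_linear i hi :=
    { support := fun x y h => by
        rw [Finset.mem_map_equiv, Finset.mem_map_equiv, Equiv.symm_swap]
        exact (P.ballot_linear i hi).support _ _ h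
      irrefl := fun x => (P.ballot_linear i hi).irrefl _
      trans := fun x y z => (P.ballot_linear i hi).trans _ _ _
      total := fun x hx y hy hne => by
        rw [Finset.mem_map_equiv, Equiv.symm_swap] at hx hy
        exact (P.ballot_linear i hi).total _ hx _ hy fun h =>
          hne ((Equiv.swap a b).injective h) }
  ballot_empty i hi x y := P.ballot_empty i hi _ _

end Profile

/-- A voting method assigns to every profile in its nonempty domain `dom` a nonempty set of
winners among the candidates of that profile. The values of `winners` outside `dom` are
irrelevant: no axiom below refers to them. -/
structure VotingMethod (𝒳 𝒱 : Type*) where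
  dom : Set (Profile 𝒳 𝒱)
  dom_nonempty : dom.Nonempty
  winners : Profile 𝒳 𝒱 → Finset 𝒳
  winners_nonempty : ∀ P ∈ dom, (winners P).Nonempty
  winners_subset : ∀ P ∈ dom, winners P ⊆ P.cands

namespace VotingMethod

variable {𝒳 𝒱 : Type*}

/-- Swapping two voters does not change the set of winners. -/
def Anonymity [DecidableEq 𝒱] (F : VotingMethod 𝒳 𝒱) : Prop :=
  ∀ P ∈ F.dom, ∀ i j : 𝒱, P.swapVoters i j ∈ F.dom → F.winners (P.swapVoters i j) = F.winners P

/-- Swapping two candidates swaps them in the set of winners. -/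
def Neutrality [DecidableEq 𝒳] (F : VotingMethod 𝒳 𝒱) : Prop :=
  ∀ P ∈ F.dom, ∀ a b : 𝒳, P.swapCands a b ∈ F.dom →
    F.winners (P.swapCands a b) = (F.winners P).map (Equiv.swap a b).toEmbedding

/-- If `x` wins without `y` and is the unique winner against `y` alone, then `x` wins
(all profiles involved being in the domain). -/
def BinaryGamma [DecidableEq 𝒳] (F : VotingMethod 𝒳 𝒱) : Prop :=
  ∀ P ∈ F.dom, ∀ x ∈ P.cands, ∀ y ∈ P.cands,
    P.remove y ∈ F.dom → P.restrict {x, y} ∈ F.dom →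
    x ∈ F.winners (P.remove y) → F.winners (P.restrict {x, y}) = {x} → x ∈ F.winners P

/-- There is exactly one winner in every uniquely weighted profile of the domain. -/
def QuasiResoluteness (F : VotingMethod 𝒳 𝒱) : Prop :=
  ∀ P ∈ F.dom, P.UniquelyWeighted → (F.winners P).card = 1

end VotingMethod

end Voting

/-! An antisymmetric matrix of weights on four candidates is realised by a profile in which the
ballots of every restriction to two or three candidates depend only on the restricted matrix
(`exists_encoding_restrict`). Anonymity and neutrality then make the verdict on such a restriction a
function of the weights alone (`Beats.winners_eq`, `CycleWins.mem_winners`).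

Quasi-resoluteness picks, for each size 1, ..., 6, a sign for which the favoured candidate wins
between two. Nothing forces this to agree with the majority, but it orients edges: the six signed
weights can be placed at will on any tournament, and every edge is then a binary victory. A
three-cycle with given weights has some winner, and naming it by the opposite edge chooses an edge
from each cyclic triple of weights.

In a strong tournament on four candidates, two three-cycles share an edge. If the choices gave two
different winners, each beating the candidate missing from its cycle, binary `γ` would make both win
in a uniquely weighted profile (`not_cycleWins_of_cycleWins`). Hence certain pairs of choices
exclude each other, and no choice on six labels avoids all of them (`no_cyclic_choice`). -/

namespace Voting

/-! ### The combinatorial contradiction on six labels. -/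

/-- There is no way to choose an edge from each cyclically ordered triple of six labels (`W i j k`
means that `i` is chosen from `i → j → k → i`) such that whenever `r` is chosen from
`r → p → q → r`, its successor `p` is not chosen from any `p → s → t → p` with `s, t` new. -/
theorem no_cyclic_choice (W : Fin 6 → Fin 6 → Fin 6 → Prop)
    (hex : ∀ i j k, [i, j, k].Nodup → W i j k ∨ W j k i ∨ W k i j)
    (hno : ∀ r p q s t o, [r, p, q, s, t, o].Nodup → W r p q → ¬ W p s t) : False := by
  -- By symmetry it suffices to exclude one choice. Below, each triple is settled by discarding two
  -- of its three edges, until one triple has none left.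
  have core : ∀ W : Fin 6 → Fin 6 → Fin 6 → Prop,
      (∀ i j k, [i, j, k].Nodup → W i j k ∨ W j k i ∨ W k i j) →
      (∀ r p q s t o, [r, p, q, s, t, o].Nodup → W r p q → ¬ W p s t) → ¬ W 0 1 2 := by
    intro W hex hno h012
    rcases hex 0 3 4 (by decide) with h034 | h340 | h403
    · have h513 : W 5 1 3 := by
        rcases hex 5 1 3 (by decide) with h | h | h
        · exact h
        · exact (hno 0 1 2 3 5 4 (by decide) h012 h).elim
        · exact (hno 0 3 4 5 1 2 (by decide) h034 h).elim
      have h025 : W 0 2 5 := by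
        rcases hex 0 2 5 (by decide) with h | h | h
        · exact h
        · exact (hno 2 5 0 1 3 4 (by decide) h h513).elim
        · exact (hno 5 0 2 3 4 1 (by decide) h h034).elim
      have h045 : W 0 4 5 := by
        rcases hex 0 4 5 (by decide) with h | h | h
        · exact h
        · exact (hno 4 5 0 1 3 2 (by decide) h h513).elim
        · exact (hno 5 0 4 1 2 3 (by decide) h h012).elim
      rcases hex 1 2 4 (by decide) with h | h | h
      · exact hno 5 1 3 2 4 0 (by decide) h513 h
      · exact hno 0 2 5 4 1 3 (by decide) h025 h
      · exact hno 0 4 5 1 2 3 (by decide) h045 h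
    · have h514 : W 5 1 4 := by
        rcases hex 5 1 4 (by decide) with h | h | h
        · exact h
        · exact (hno 0 1 2 4 5 3 (by decide) h012 h).elim
        · exact (hno 3 4 0 5 1 2 (by decide) h340 h).elim
      have h035 : W 0 3 5 := by
        rcases hex 0 3 5 (by decide) with h | h | h
        · exact h
        · exact (hno 3 5 0 1 4 2 (by decide) h h514).elim
        · exact (hno 5 0 3 1 2 4 (by decide) h h012).elim
      rcases hex 1 2 3 (by decide) with h | h | h
      · exact hno 5 1 4 2 3 0 (by decide) h514 h
      · exact hno 2 3 1 4 0 5 (by decide) h h340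
      · exact hno 0 3 5 1 2 4 (by decide) h035 h
    · exact hno 4 0 3 1 2 5 (by decide) h403 h012
  -- The hypotheses are invariant under relabelling. The two products of transpositions used below
  -- are the rotations of 0, 1, 2.
  have transport : ∀ σ : Equiv.Perm (Fin 6), ¬ W (σ 0) (σ 1) (σ 2) := fun σ =>
    core (fun i j k => W (σ i) (σ j) (σ k))
      (fun i j k h => hex _ _ _ (List.Nodup.map (f := σ) σ.injective h))
      (fun r p q s t o h => hno _ _ _ _ _ (σ o) (List.Nodup.map (f := σ) σ.injective h))
  rcases hex 0 1 2 (by decide) with h | h | h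
  · exact transport 1 h
  · refine transport (Equiv.swap 0 1 * Equiv.swap 1 2) ?_
    convert h using 1 <;> decide
  · refine transport (Equiv.swap 1 2 * Equiv.swap 0 1) ?_
    convert h using 1 <;> decide

/-! ### Anonymity: only the number of copies of each ballot matters. -/

namespace Profile

variable {𝒳 𝒱 : Type*}

/-- The profile obtained from `P` by renaming the voters along the permutation `π`. -/
def permVoters (P : Profile 𝒳 𝒱) (π : Equiv.Perm 𝒱) : Profile 𝒳 𝒱 where
  voters := P.voters.map π.toEmbedding
  cands := P.cands
  ballot k := P.ballot (π.symm k)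
  ballot_linear _ hk := P.ballot_linear _ (Finset.mem_map_equiv.1 hk)
  ballot_empty _ hk := P.ballot_empty _ fun h => hk (Finset.mem_map_equiv.2 h)

theorem permVoters_one (P : Profile 𝒳 𝒱) : P.permVoters 1 = P := by
  ext1
  · exact Finset.map_refl
  · rfl
  · rfl

theorem permVoters_swap_mul [DecidableEq 𝒱] (P : Profile 𝒳 𝒱) (i j : 𝒱) (π : Equiv.Perm 𝒱) :
    P.permVoters (Equiv.swap i j * π) = (P.permVoters π).swapVoters i j := by
  ext1
  · change P.voters.map _ = (P.voters.map _).map _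
    rw [Finset.map_map]
    rfl
  · rfl
  · rfl

/-- The voters of `P` can be matched with the voters of `Q` casting the same ballot, provided every
ballot is cast equally often in both profiles. -/
theorem exists_equiv_of_ncard_eq {P Q : Profile 𝒳 𝒱}
    (h : ∀ R, {i | i ∈ P.voters ∧ P.ballot i = R}.ncard =
      {i | i ∈ Q.voters ∧ Q.ballot i = R}.ncard) :
    ∃ e : P.voters ≃ Q.voters, ∀ i, Q.ballot (e i) = P.ballot i := by
  have key : ∀ R, Nonempty ({i : P.voters // P.ballot i = R} ≃ {i : Q.voters // Q.ballot i = R}) := by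
    intro R
    have aux : ∀ P : Profile 𝒳 𝒱, Nat.card {i : P.voters // P.ballot i = R} =
        {i | i ∈ P.voters ∧ P.ballot i = R}.ncard := fun P =>
      Nat.card_congr (Equiv.subtypeSubtypeEquivSubtypeInter (· ∈ P.voters) (P.ballot · = R))
    have := (aux P).trans ((h R).trans (aux Q).symm)
    exact Finite.card_eq.1 this
  let e : P.voters ≃ Q.voters :=
    (Equiv.sigmaFiberEquiv fun i : P.voters => P.ballot i).symm.trans
      ((Equiv.sigmaCongrRight fun R => (key R).some).trans
        (Equiv.sigmaFiberEquiv fun i : Q.voters => Q.ballot i))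
  exact ⟨e, fun i => ((key (P.ballot i)).some ⟨i, rfl⟩).2⟩

end Profile

namespace VotingMethod

variable {𝒳 𝒱 : Type*} {F : VotingMethod 𝒳 𝒱}

/-- `F` is defined on all profiles with voters, candidates, and at most four candidates. -/
def DefinedUpToFour (F : VotingMethod 𝒳 𝒱) : Prop :=
  ∀ P : Profile 𝒳 𝒱, P.voters.Nonempty → P.cands.Nonempty → P.cands.card ≤ 4 → P ∈ F.dom

/-- Permutations supported on a finite set `U` are products of transpositions, which an arbitrary
permutation of the infinite voter set need not be. -/
theorem Anonymity.winners_permVoters [DecidableEq 𝒱] (hA : F.Anonymity) (hF : F.DefinedUpToFour)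
    {P : Profile 𝒳 𝒱} (hv : P.voters.Nonempty) (hc : P.cands.Nonempty) (h4 : P.cands.card ≤ 4)
    (U : Finset 𝒱) (π : Equiv.Perm U) :
    F.winners (P.permVoters (Equiv.Perm.ofSubtype π)) = F.winners P := by
  have hd : ∀ π, P.permVoters π ∈ F.dom := fun π => hF _ (by simpa [Profile.permVoters]) hc h4
  induction π using Equiv.Perm.swap_induction_on with
  | one => rw [map_one, Profile.permVoters_one]
  | swap_mul π i j _ ih =>
    rw [map_mul, Equiv.Perm.ofSubtype_swap_eq, Profile.permVoters_swap_mul, ← ih]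
    refine hA _ (hd _) _ _ ?_
    rw [← Profile.permVoters_swap_mul]
    exact hd _

/-- Under anonymity the winners depend only on how often each ballot is cast. -/
theorem Anonymity.winners_eq [DecidableEq 𝒱] (hA : F.Anonymity) (hF : F.DefinedUpToFour)
    {P Q : Profile 𝒳 𝒱} (hv : P.voters.Nonempty) (hc : P.cands.Nonempty) (h4 : P.cands.card ≤ 4)
    (hPQ : P.cands = Q.cands)
    (h : ∀ R, {i | i ∈ P.voters ∧ P.ballot i = R}.ncard =
      {i | i ∈ Q.voters ∧ Q.ballot i = R}.ncard) :
    F.winners P = F.winners Q := by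
  obtain ⟨e, he⟩ := Profile.exists_equiv_of_ncard_eq h
  -- The matching of voters is extended to a permutation of the finite set `P.voters ∪ Q.voters`;
  -- the values of `f` off `P.voters` play no role.
  let f : ↥(P.voters ∪ Q.voters) → 𝒱 := fun i => if hi : i.1 ∈ P.voters then e ⟨i, hi⟩ else i
  obtain ⟨g, hg⟩ := Finset.exists_equiv_extend_of_card_eq (t := P.voters ∪ Q.voters)
    (s := Finset.univ.filter fun i : ↥(P.voters ∪ Q.voters) => i.1 ∈ P.voters) (f := f)
    (by simp) (by
      intro x hx
      simp only [Finset.mem_image, Finset.mem_filter, Finset.mem_univ, true_and] at hx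
      obtain ⟨i, hi, rfl⟩ := hx
      simp [f, hi]) (by
      intro i hi j hj hij
      simp only [Finset.coe_filter, Finset.mem_univ, true_and, Set.mem_ofPred_eq] at hi hj
      simp only [f, hi, hj, dite_true] at hij
      simpa using Subtype.ext_iff.1 (e.injective (Subtype.ext hij)) |> Subtype.ext)
  set π := Equiv.Perm.ofSubtype g with hπ
  have hπe : ∀ i (hi : i ∈ P.voters), π i = e ⟨i, hi⟩ := by
    intro i hi
    rw [hπ, Equiv.Perm.ofSubtype_apply_of_mem g (Finset.mem_union_left _ hi), hg _ (by simpa)]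
    simp [f, hi]
  rw [← hA.winners_permVoters hF hv hc h4 _ g, ← hπ]
  congr 1
  have hmem : ∀ k, π.symm k ∈ P.voters ↔ k ∈ Q.voters := by
    intro k
    constructor
    · intro hk
      have := hπe _ hk
      rw [Equiv.apply_symm_apply] at this
      rw [this]
      exact (e _).2
    · intro hk
      have h1 := hπe _ (e.symm ⟨k, hk⟩).2
      simp only [Subtype.coe_eta, Equiv.apply_symm_apply] at h1
      rw [← h1, Equiv.symm_apply_apply]
      exact (e.symm ⟨k, hk⟩).2
  ext1
  · ext k
    rw [← hmem k]
    exact Finset.mem_map_equiv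
  · exact hPQ
  · funext k
    change P.ballot (π.symm k) = Q.ballot k
    by_cases hk : k ∈ Q.voters
    · have hk' := (hmem k).2 hk
      rw [← he ⟨_, hk'⟩, ← hπe, Equiv.apply_symm_apply]
    · ext x y
      exact iff_of_false (P.ballot_empty _ (mt (hmem k).1 hk) x y) (Q.ballot_empty k hk x y)

end VotingMethod

/-! ### Counting ballot patterns and encoding weights in profiles. -/

namespace Profile

variable {𝒳 𝒱 : Type*}

/-- The number of voters who rank `p` above `q`. -/
noncomputable def count₂ (P : Profile 𝒳 𝒱) (p q : 𝒳) : ℕ := {i | P.ballot i p q}.ncard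

/-- The number of voters who rank `p` above `q` above `r`. -/
noncomputable def count₃ (P : Profile 𝒳 𝒱) (p q r : 𝒳) : ℕ :=
  {i | P.ballot i p q ∧ P.ballot i q r}.ncard

/-- The number of voters who rank `p` above `q` above `r` above `s`. -/
noncomputable def count₄ (P : Profile 𝒳 𝒱) (p q r s : 𝒳) : ℕ :=
  {i | P.ballot i p q ∧ P.ballot i q r ∧ P.ballot i r s}.ncard

theorem mem_voters_of_ballot {P : Profile 𝒳 𝒱} {i : 𝒱} {x y : 𝒳} (h : P.ballot i x y) :
    i ∈ P.voters :=
  by_contra fun hi => P.ballot_empty i hi x y h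

instance finite_setOf_ballot_and (P : Profile 𝒳 𝒱) (x y : 𝒳) (p : 𝒱 → Prop) :
    Finite {i | P.ballot i x y ∧ p i} :=
  (P.voters.finite_toSet.subset fun _ hi => mem_voters_of_ballot hi.1).to_subtype

theorem margin_eq (P : Profile 𝒳 𝒱) (x y : 𝒳) :
    P.margin x y = (P.count₂ x y : ℤ) - P.count₂ y x := by
  classical
  have h : ∀ x y, P.count₂ x y = (P.voters.filter fun i => P.ballot i x y).card := by
    intro x y
    rw [count₂, ← Set.ncard_coe_finset]
    congr 1
    ext i
    simpa using mem_voters_of_ballot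
  simp only [margin, h]

theorem count₂_eq (P : Profile 𝒳 𝒱) {p q s : 𝒳} (hp : p ∈ P.cands) (hq : q ∈ P.cands)
    (hs : s ∈ P.cands) (hsp : s ≠ p) (hsq : s ≠ q) :
    P.count₂ p q = P.count₃ s p q + P.count₃ p s q + P.count₃ p q s := by
  rw [count₂, count₃, count₃, count₃, ← Set.ncard_union_eq, ← Set.ncard_union_eq]
  · congr 1
    ext i
    simp only [Set.mem_union, Set.mem_ofPred_eq]
    constructor
    · intro h
      have hl := P.ballot_linear i (mem_voters_of_ballot h)
      have h1 := hl.total s hs p hp hsp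
      have h2 := hl.total s hs q hq hsq
      tauto
    · rintro ((h | h) | h)
      · exact h.2
      · exact (P.ballot_linear i (mem_voters_of_ballot h.1)).trans _ _ _ h.1 h.2
      · exact h.1
  · refine Set.disjoint_left.2 fun i hi h => ?_
    simp only [Set.mem_union, Set.mem_ofPred_eq] at hi h
    have hl := P.ballot_linear i (mem_voters_of_ballot h.1)
    have := hl.irrefl
    have := hl.trans
    grind
  · refine Set.disjoint_left.2 fun i hi h => ?_
    simp only [Set.mem_ofPred_eq] at hi h
    have hl := P.ballot_linear i (mem_voters_of_ballot h.1)
    have := hl.irrefl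
    have := hl.trans
    grind

theorem count₃_eq (P : Profile 𝒳 𝒱) {p q r s : 𝒳} (hp : p ∈ P.cands) (hq : q ∈ P.cands)
    (hr : r ∈ P.cands) (hs : s ∈ P.cands) (hsp : s ≠ p) (hsq : s ≠ q) (hsr : s ≠ r) :
    P.count₃ p q r =
      P.count₄ s p q r + P.count₄ p s q r + P.count₄ p q s r + P.count₄ p q r s := by
  rw [count₃, count₄, count₄, count₄, count₄, ← Set.ncard_union_eq, ← Set.ncard_union_eq,
    ← Set.ncard_union_eq]
  · congr 1
    ext i
    simp only [Set.mem_union, Set.mem_ofPred_eq]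
    constructor
    · intro h
      have hl := P.ballot_linear i (mem_voters_of_ballot h.1)
      have h1 := hl.total s hs p hp hsp
      have h2 := hl.total s hs q hq hsq
      have h3 := hl.total s hs r hr hsr
      tauto
    · rintro (((h | h) | h) | h)
      · exact h.2
      · exact ⟨(P.ballot_linear i (mem_voters_of_ballot h.1)).trans _ _ _ h.1 h.2.1, h.2.2⟩
      · exact ⟨h.1, (P.ballot_linear i (mem_voters_of_ballot h.1)).trans _ _ _ h.2.1 h.2.2⟩
      · exact ⟨h.1, h.2.1⟩
  · refine Set.disjoint_left.2 fun i hi h => ?_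
    simp only [Set.mem_union, Set.mem_ofPred_eq] at hi h
    have hl := P.ballot_linear i (mem_voters_of_ballot h.1)
    have := hl.irrefl
    have := hl.trans
    grind
  · refine Set.disjoint_left.2 fun i hi h => ?_
    simp only [Set.mem_union, Set.mem_ofPred_eq] at hi h
    have hl := P.ballot_linear i (mem_voters_of_ballot h.1)
    have := hl.irrefl
    have := hl.trans
    grind
  · refine Set.disjoint_left.2 fun i hi h => ?_
    simp only [Set.mem_ofPred_eq] at hi h
    have hl := P.ballot_linear i (mem_voters_of_ballot h.1)
    have := hl.irrefl
    have := hl.trans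
    grind

/-- A profile of four candidates in which each ballot is cast a prescribed number of times. -/
theorem exists_count₄_eq [Infinite 𝒱] (x : Fin 4 ↪ 𝒳) (n : Equiv.Perm (Fin 4) → ℕ) :
    ∃ P : Profile 𝒳 𝒱, P.cands = Finset.univ.map x ∧
      ∀ σ, P.count₄ (x (σ 0)) (x (σ 1)) (x (σ 2)) (x (σ 3)) = n σ := by
  let V := Σ σ : Equiv.Perm (Fin 4), Fin (n σ)
  let ι : V ↪ 𝒱 := (Fintype.equivFin V).toEmbedding.trans
    (Fin.valEmbedding.trans (Infinite.natEmbedding 𝒱))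
  -- The ballot of type `σ` lists `σ 0, σ 1, σ 2, σ 3` from the top, so `σ.symm` gives the position
  -- of a candidate.
  let b : 𝒱 → 𝒳 → 𝒳 → Prop := fun i y z =>
    ∃ v : V, ι v = i ∧ ∃ j k, v.1.symm j < v.1.symm k ∧ x j = y ∧ x k = z
  have hb : ∀ v j k, b (ι v) (x j) (x k) ↔ v.1.symm j < v.1.symm k := by
    intro v j k
    constructor
    · rintro ⟨v', hv, j', k', h, hj, hk⟩
      obtain rfl := ι.injective hv
      obtain rfl := x.injective hj
      obtain rfl := x.injective hk
      exact h
    · exact fun h => ⟨v, rfl, j, k, h, rfl, rfl⟩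
  refine ⟨⟨Finset.univ.map ι, Finset.univ.map x, b, ?_, ?_⟩, rfl, ?_⟩
  · intro i hi
    obtain ⟨v, -, rfl⟩ := Finset.mem_map.1 hi
    refine ⟨?_, ?_, ?_, ?_⟩
    · rintro _ _ ⟨_, _, j, k, _, rfl, rfl⟩
      simp
    · rintro y ⟨v', _, j, k, h, rfl, hk⟩
      obtain rfl := x.injective hk
      exact lt_irrefl _ h
    · rintro _ y _ ⟨v', hv', j, k, h, rfl, rfl⟩ hyz
      obtain ⟨v'', hv'', k', l, h', hk', rfl⟩ := id hyz
      obtain rfl := x.injective hk'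
      obtain rfl := ι.injective hv'
      obtain rfl := ι.injective hv''
      exact (hb _ _ _).2 (h.trans h')
    · intro y hy z hz hyz
      obtain ⟨j, -, rfl⟩ := Finset.mem_map.1 hy
      obtain ⟨k, -, rfl⟩ := Finset.mem_map.1 hz
      rw [hb, hb]
      exact lt_or_gt_of_ne fun h => hyz (by rw [v.1.symm.injective h])
  · rintro i hi y z ⟨v, rfl, _⟩
    exact hi (by simp)
  · intro σ
    have hset : {i | b i (x (σ 0)) (x (σ 1)) ∧ b i (x (σ 1)) (x (σ 2)) ∧
        b i (x (σ 2)) (x (σ 3))} = Set.range fun k : Fin (n σ) => ι ⟨σ, k⟩ := by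
      ext i
      constructor
      · rintro ⟨⟨v, rfl, h⟩, h1, h2⟩
        have h0 := (hb _ _ _).1 ⟨v, rfl, h⟩
        rw [hb] at h1 h2
        have hid : ∀ τ : Equiv.Perm (Fin 4), τ 0 < τ 1 → τ 1 < τ 2 → τ 2 < τ 3 → τ = 1 := by
          decide
        obtain ⟨τ, k⟩ := v
        obtain rfl : τ = σ := inv_mul_eq_one.1 (hid (τ⁻¹ * σ) h0 h1 h2)
        exact ⟨k, rfl⟩
      · rintro ⟨k, rfl⟩
        simp [hb]
    change Set.ncard {i | b i (x (σ 0)) (x (σ 1)) ∧ b i (x (σ 1)) (x (σ 2)) ∧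
        b i (x (σ 2)) (x (σ 3))} = n σ
    rw [hset, ← Nat.card_coe_set_eq, Nat.card_range_of_injective, Nat.card_fin]
    intro k l h
    exact eq_of_heq (Sigma.mk.inj (ι.injective h)).2

/-- Profiles of four candidates encoding an antisymmetric matrix of small weights in such a way
that the ballots of a restriction are determined by the restriction of the matrix. -/
theorem exists_encoding [Infinite 𝒱] (x : Fin 4 ↪ 𝒳) (M : Fin 4 → Fin 4 → ℤ)
    (hM : ∀ i j, M j i = -M i j) (hM6 : ∀ i j, |M i j| ≤ 6) :
    ∃ P : Profile 𝒳 𝒱, P.cands = Finset.univ.map x ∧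
      (∀ i j k, [i, j, k].Nodup →
        (P.count₃ (x i) (x j) (x k) : ℤ) = 72 + 3 * (M i j + M j k)) ∧
      (∀ i j, i ≠ j → (P.count₂ (x i) (x j) : ℤ) = 216 + 6 * M i j) := by
  obtain ⟨P, hP, hn⟩ := exists_count₄_eq (𝒱 := 𝒱) x
    -- Three weights of absolute value at most 6 sum to at least -18, so `toNat` truncates nothing.
    fun σ => (18 + M (σ 0) (σ 1) + M (σ 1) (σ 2) + M (σ 2) (σ 3)).toNat
  have hx : ∀ i, x i ∈ P.cands := by simp [hP]
  have h4 : ∀ i j k l, [i, j, k, l].Nodup →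
      (P.count₄ (x i) (x j) (x k) (x l) : ℤ) = 18 + M i j + M j k + M k l := by
    intro i j k l h
    have hinj : Function.Injective ![i, j, k, l] := by
      rw [← List.nodup_ofFn]
      simpa using h
    have := hn (Equiv.ofBijective _ (Finite.injective_iff_bijective.1 hinj))
    simp only [Equiv.ofBijective_apply, Matrix.cons_val] at this
    rw [this]
    have h1 := abs_le.1 (hM6 i j)
    have h2 := abs_le.1 (hM6 j k)
    have h3 := abs_le.1 (hM6 k l)
    omega
  have h3 : ∀ i j k, [i, j, k].Nodup →
      (P.count₃ (x i) (x j) (x k) : ℤ) = 72 + 3 * (M i j + M j k) := by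
    intro i j k h
    obtain ⟨l, hl⟩ : ∃ l, l ≠ i ∧ l ≠ j ∧ l ≠ k := by
      clear h
      revert i j k
      decide
    have hne : ∀ {a b}, a ≠ b → x a ≠ x b := fun h h' => h (x.injective h')
    -- Of the four places to insert `l`, three preserve each link of the chain, which gives the
    -- factor 3; the links with `l` cancel by antisymmetry. The same cancellation recurs for pairs
    -- below.
    rw [P.count₃_eq (hx i) (hx j) (hx k) (hx l) (hne hl.1) (hne hl.2.1) (hne hl.2.2)]
    simp only [List.nodup_cons, List.mem_cons, List.not_mem_nil, or_false, not_or] at h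
    push_cast
    rw [h4, h4, h4, h4, hM l i, hM l j, hM l k]
    · ring
    all_goals simp only [List.nodup_cons, List.mem_cons, List.not_mem_nil, or_false, not_or]; grind
  refine ⟨P, hP, h3, fun i j hij => ?_⟩
  obtain ⟨l, hl⟩ : ∃ l, l ≠ i ∧ l ≠ j := by
    clear hij
    revert i j
    decide
  have hne : ∀ {a b}, a ≠ b → x a ≠ x b := fun h h' => h (x.injective h')
  rw [P.count₂_eq (hx i) (hx j) (hx l) (hne hl.1) (hne hl.2)]
  push_cast
  rw [h3, h3, h3, hM l i, hM l j]
  · ring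
  all_goals simp only [List.nodup_cons, List.mem_cons, List.not_mem_nil, or_false, not_or]; grind

end Profile

/-! ### Profiles on two and three candidates determined by their weights. -/

theorem IsStrictLinearOrderOn.le_of_chain {𝒳 : Type*} {X : Finset 𝒳} {R R' : 𝒳 → 𝒳 → Prop}
    (hR : IsStrictLinearOrderOn X R) (hR' : IsStrictLinearOrderOn X R') {p q r : 𝒳}
    (hX : ∀ x ∈ X, x = p ∨ x = q ∨ x = r) (h : R p q ∧ R q r) (h' : R' p q ∧ R' q r) {x y : 𝒳}
    (hxy : R x y) : R' x y := by
  have hpr := hR.trans _ _ _ h.1 h.2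
  have hpr' := hR'.trans _ _ _ h'.1 h'.2
  have asymm : ∀ {x y}, R x y → ¬ R y x := fun h h' => hR.irrefl _ (hR.trans _ _ _ h h')
  have irr := hR.irrefl x
  obtain ⟨hx, hy⟩ := hR.support x y hxy
  rcases hX x hx with rfl | rfl | rfl <;> rcases hX y hy with rfl | rfl | rfl
  · exact (irr hxy).elim
  · exact h'.1
  · exact hpr'
  · exact (asymm hxy h.1).elim
  · exact (irr hxy).elim
  · exact h'.2
  · exact (asymm hxy hpr).elim
  · exact (asymm hxy h.2).elim
  · exact (irr hxy).elim

namespace Profile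

variable {𝒳 𝒱 : Type*}

theorem ncard_ballot_eq (P : Profile 𝒳 𝒱) {R : 𝒳 → 𝒳 → Prop}
    (hR : IsStrictLinearOrderOn P.cands R) {p q r : 𝒳}
    (hX : ∀ x ∈ P.cands, x = p ∨ x = q ∨ x = r) (h : R p q ∧ R q r) :
    {i | i ∈ P.voters ∧ P.ballot i = R}.ncard = P.count₃ p q r := by
  rw [count₃]
  congr 1
  ext i
  simp only [Set.mem_ofPred_eq]
  constructor
  · rintro ⟨-, rfl⟩
    exact h
  · intro hi
    have hv := mem_voters_of_ballot hi.1
    refine ⟨hv, ?_⟩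
    ext x y
    exact ⟨(P.ballot_linear i hv).le_of_chain hR hX hi h,
      hR.le_of_chain (P.ballot_linear i hv) hX h hi⟩

theorem ncard_ballot_eq_of_pair (P : Profile 𝒳 𝒱) {R : 𝒳 → 𝒳 → Prop}
    (hR : IsStrictLinearOrderOn P.cands R) {p q : 𝒳}
    (hX : ∀ x ∈ P.cands, x = p ∨ x = q) (h : R p q) :
    {i | i ∈ P.voters ∧ P.ballot i = R}.ncard = P.count₂ p q := by
  rw [count₂]
  congr 1
  ext i
  simp only [Set.mem_ofPred_eq]
  constructor
  · rintro ⟨-, rfl⟩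
    exact h
  · intro hi
    have hv := mem_voters_of_ballot hi
    refine ⟨hv, ?_⟩
    have hP := P.ballot_linear i hv
    have key : ∀ {R R' : 𝒳 → 𝒳 → Prop}, IsStrictLinearOrderOn P.cands R → R p q → R' p q →
        ∀ {x y}, R x y → R' x y := by
      intro R R' hR h h' x y hxy
      obtain ⟨hx, hy⟩ := hR.support x y hxy
      rcases hX x hx with rfl | rfl <;> rcases hX y hy with rfl | rfl
      · exact (hR.irrefl _ hxy).elim
      · exact h'
      · exact (hR.irrefl _ (hR.trans _ _ _ hxy h)).elim
      · exact (hR.irrefl _ hxy).elim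
    ext x y
    exact ⟨key hP hi h, key hR h hi⟩

/-- The number of voters casting a given ballot is determined by its values at linear orders. -/
theorem ncard_ballot_congr {P Q : Profile 𝒳 𝒱} (hPQ : P.cands = Q.cands) {R : 𝒳 → 𝒳 → Prop}
    (h : IsStrictLinearOrderOn P.cands R → {i | i ∈ P.voters ∧ P.ballot i = R}.ncard =
      {i | i ∈ Q.voters ∧ Q.ballot i = R}.ncard) :
    {i | i ∈ P.voters ∧ P.ballot i = R}.ncard = {i | i ∈ Q.voters ∧ Q.ballot i = R}.ncard := by
  by_cases hR : IsStrictLinearOrderOn P.cands R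
  · exact h hR
  · have : ∀ P : Profile 𝒳 𝒱, ¬ IsStrictLinearOrderOn P.cands R →
        {i | i ∈ P.voters ∧ P.ballot i = R} = ∅ := by
      intro P hR
      ext i
      simp only [Set.mem_ofPred_eq, Set.mem_empty_iff_false, iff_false]
      rintro ⟨hi, rfl⟩
      exact hR (P.ballot_linear i hi)
    rw [this P hR, this Q (hPQ ▸ hR)]

/-- A profile of the two candidates `a` and `b` whose ballots encode the weight `u` of `a`
over `b`. -/
structure IsPair (P : Profile 𝒳 𝒱) (a b : 𝒳) (u : ℤ) : Prop where
  nonempty : P.voters.Nonempty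
  ne : a ≠ b
  mem_cands : ∀ x, x ∈ P.cands ↔ x = a ∨ x = b
  count_ab : (P.count₂ a b : ℤ) = 216 + 6 * u
  count_ba : (P.count₂ b a : ℤ) = 216 - 6 * u

/-- A profile of the three candidates `a`, `b` and `c` whose ballots encode the weights `u` of `a`
over `b`, `v` of `b` over `c`, and `w` of `c` over `a`. -/
structure IsCycle (P : Profile 𝒳 𝒱) (a b c : 𝒳) (u v w : ℤ) : Prop where
  nonempty : P.voters.Nonempty
  ne_ab : a ≠ b
  ne_bc : b ≠ c
  ne_ca : c ≠ a
  mem_cands : ∀ x, x ∈ P.cands ↔ x = a ∨ x = b ∨ x = c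
  count_abc : (P.count₃ a b c : ℤ) = 72 + 3 * (u + v)
  count_bca : (P.count₃ b c a : ℤ) = 72 + 3 * (v + w)
  count_cab : (P.count₃ c a b : ℤ) = 72 + 3 * (w + u)
  count_cba : (P.count₃ c b a : ℤ) = 72 - 3 * (v + u)
  count_bac : (P.count₃ b a c : ℤ) = 72 - 3 * (u + w)
  count_acb : (P.count₃ a c b : ℤ) = 72 - 3 * (w + v)

variable {P Q : Profile 𝒳 𝒱} {a b c : 𝒳} {u v w : ℤ}

theorem IsPair.symm (h : P.IsPair a b u) : P.IsPair b a (-u) where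
  nonempty := h.nonempty
  ne := h.ne.symm
  mem_cands x := by rw [h.mem_cands, or_comm]
  count_ab := by rw [h.count_ba]; ring
  count_ba := by rw [h.count_ab]; ring

theorem IsCycle.rotate (h : P.IsCycle a b c u v w) : P.IsCycle b c a v w u where
  nonempty := h.nonempty
  ne_ab := h.ne_bc
  ne_bc := h.ne_ca
  ne_ca := h.ne_ab
  mem_cands x := by rw [h.mem_cands]; tauto
  count_abc := h.count_bca
  count_bca := h.count_cab
  count_cab := h.count_abc
  count_cba := h.count_acb
  count_bac := h.count_cba
  count_acb := h.count_bac

theorem IsPair.cands_nonempty (h : P.IsPair a b u) : P.cands.Nonempty :=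
  ⟨a, (h.mem_cands a).2 (Or.inl rfl)⟩

theorem IsCycle.cands_nonempty (h : P.IsCycle a b c u v w) : P.cands.Nonempty :=
  ⟨a, (h.mem_cands a).2 (Or.inl rfl)⟩

theorem IsPair.card_le (h : P.IsPair a b u) : P.cands.card ≤ 4 := by
  classical
  have : P.cands = {a, b} := by ext; simp [h.mem_cands]
  rw [this]
  exact Finset.card_le_two.trans (by norm_num)

theorem IsCycle.card_le (h : P.IsCycle a b c u v w) : P.cands.card ≤ 4 := by
  classical
  have : P.cands = {a, b, c} := by ext; simp [h.mem_cands]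
  rw [this]
  exact Finset.card_le_three.trans (by norm_num)

theorem IsPair.uniquelyWeighted (h : P.IsPair a b u) (hu : u ≠ 0) : P.UniquelyWeighted := by
  have h1 := h.count_ab
  have h2 := h.count_ba
  intro x hx y hy z hz t ht hxy hzt hne
  rw [h.mem_cands] at hx hy hz ht
  rw [margin_eq, margin_eq]
  grind

/-- The two recorded counts cover both orders of the candidates, as the six of `IsCycle` cover all
orders of three; this is the input that anonymity needs. -/
theorem IsPair.ncard_ballot_eq (hP : P.IsPair a b u) (hQ : Q.IsPair a b u) (R : 𝒳 → 𝒳 → Prop) :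
    {i | i ∈ P.voters ∧ P.ballot i = R}.ncard = {i | i ∈ Q.voters ∧ Q.ballot i = R}.ncard := by
  have hPQ : P.cands = Q.cands := by ext; rw [hP.mem_cands, hQ.mem_cands]
  refine ncard_ballot_congr hPQ fun hR => ?_
  rcases hR.total a (by simp [hP.mem_cands]) b (by simp [hP.mem_cands]) hP.ne with h | h
  · rw [P.ncard_ballot_eq_of_pair hR (fun x hx => (hP.mem_cands x).1 hx) h,
      Q.ncard_ballot_eq_of_pair (hPQ ▸ hR) (fun x hx => (hQ.mem_cands x).1 hx) h]
    exact_mod_cast hP.count_ab.trans hQ.count_ab.symm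
  · rw [P.ncard_ballot_eq_of_pair hR (fun x hx => ((hP.mem_cands x).1 hx).symm) h,
      Q.ncard_ballot_eq_of_pair (hPQ ▸ hR) (fun x hx => ((hQ.mem_cands x).1 hx).symm) h]
    exact_mod_cast hP.count_ba.trans hQ.count_ba.symm

theorem IsCycle.ncard_ballot_eq (hP : P.IsCycle a b c u v w) (hQ : Q.IsCycle a b c u v w)
    (R : 𝒳 → 𝒳 → Prop) :
    {i | i ∈ P.voters ∧ P.ballot i = R}.ncard = {i | i ∈ Q.voters ∧ Q.ballot i = R}.ncard := by
  have hPQ : P.cands = Q.cands := by ext; rw [hP.mem_cands, hQ.mem_cands]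
  refine ncard_ballot_congr hPQ fun hR => ?_
  have key : ∀ {p q r}, (∀ x, x = a ∨ x = b ∨ x = c ↔ x = p ∨ x = q ∨ x = r) →
      P.count₃ p q r = Q.count₃ p q r → R p q ∧ R q r →
      {i | i ∈ P.voters ∧ P.ballot i = R}.ncard = {i | i ∈ Q.voters ∧ Q.ballot i = R}.ncard := by
    intro p q r hX hc h
    rw [P.ncard_ballot_eq hR (fun x hx => (hX x).1 ((hP.mem_cands x).1 hx)) h,
      Q.ncard_ballot_eq (hPQ ▸ hR) (fun x hx => (hX x).1 ((hQ.mem_cands x).1 hx)) h, hc]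
  have ha := (hP.mem_cands a).2 (by simp)
  have hb := (hP.mem_cands b).2 (by simp)
  have hc := (hP.mem_cands c).2 (by simp)
  rcases hR.total a ha b hb hP.ne_ab with hab | hba <;>
    rcases hR.total b hb c hc hP.ne_bc with hbc | hcb
  · refine key (fun x => by tauto) ?_ ⟨hab, hbc⟩
    exact_mod_cast hP.count_abc.trans hQ.count_abc.symm
  · rcases hR.total c hc a ha hP.ne_ca with hca | hac
    · refine key (fun x => by tauto) ?_ ⟨hca, hab⟩
      exact_mod_cast hP.count_cab.trans hQ.count_cab.symm
    · refine key (fun x => by tauto) ?_ ⟨hac, hcb⟩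
      exact_mod_cast hP.count_acb.trans hQ.count_acb.symm
  · rcases hR.total c hc a ha hP.ne_ca with hca | hac
    · refine key (fun x => by tauto) ?_ ⟨hbc, hca⟩
      exact_mod_cast hP.count_bca.trans hQ.count_bca.symm
    · refine key (fun x => by tauto) ?_ ⟨hba, hac⟩
      exact_mod_cast hP.count_bac.trans hQ.count_bac.symm
  · refine key (fun x => by tauto) ?_ ⟨hcb, hba⟩
    exact_mod_cast hP.count_cba.trans hQ.count_cba.symm

/-! ### Renaming candidates and restricting encoded profiles. -/

section DecidableEq

variable [DecidableEq 𝒳]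

theorem mem_cands_swapCands (P : Profile 𝒳 𝒱) (x y z : 𝒳) :
    z ∈ (P.swapCands x y).cands ↔ Equiv.swap x y z ∈ P.cands := by
  rw [swapCands, Finset.mem_map_equiv, Equiv.symm_swap]

theorem count₂_swapCands (P : Profile 𝒳 𝒱) (x y p q : 𝒳) :
    (P.swapCands x y).count₂ (Equiv.swap x y p) (Equiv.swap x y q) = P.count₂ p q := by
  simp [count₂, swapCands]

theorem count₃_swapCands (P : Profile 𝒳 𝒱) (x y p q r : 𝒳) :
    (P.swapCands x y).count₃ (Equiv.swap x y p) (Equiv.swap x y q) (Equiv.swap x y r) =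
      P.count₃ p q r := by
  simp [count₃, swapCands]

theorem IsPair.swapCands (h : P.IsPair a b u) (x y : 𝒳) :
    (P.swapCands x y).IsPair (Equiv.swap x y a) (Equiv.swap x y b) u where
  nonempty := h.nonempty
  ne := (Equiv.swap x y).injective.ne h.ne
  mem_cands z := by
    rw [mem_cands_swapCands, h.mem_cands]
    simp only [Equiv.swap_apply_eq_iff]
  count_ab := by rw [count₂_swapCands, h.count_ab]
  count_ba := by rw [count₂_swapCands, h.count_ba]

theorem IsCycle.swapCands (h : P.IsCycle a b c u v w) (x y : 𝒳) :
    (P.swapCands x y).IsCycle (Equiv.swap x y a) (Equiv.swap x y b) (Equiv.swap x y c) u v w where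
  nonempty := h.nonempty
  ne_ab := (Equiv.swap x y).injective.ne h.ne_ab
  ne_bc := (Equiv.swap x y).injective.ne h.ne_bc
  ne_ca := (Equiv.swap x y).injective.ne h.ne_ca
  mem_cands z := by
    rw [mem_cands_swapCands, h.mem_cands]
    simp only [Equiv.swap_apply_eq_iff]
  count_abc := by rw [count₃_swapCands, h.count_abc]
  count_bca := by rw [count₃_swapCands, h.count_bca]
  count_cab := by rw [count₃_swapCands, h.count_cab]
  count_cba := by rw [count₃_swapCands, h.count_cba]
  count_bac := by rw [count₃_swapCands, h.count_bac]
  count_acb := by rw [count₃_swapCands, h.count_acb]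

theorem count₂_restrict (P : Profile 𝒳 𝒱) {A : Finset 𝒳} {p q : 𝒳} (hp : p ∈ A) (hq : q ∈ A) :
    (P.restrict A).count₂ p q = P.count₂ p q := by
  simp [count₂, restrict, hp, hq]

theorem count₃_restrict (P : Profile 𝒳 𝒱) {A : Finset 𝒳} {p q r : 𝒳} (hp : p ∈ A) (hq : q ∈ A)
    (hr : r ∈ A) : (P.restrict A).count₃ p q r = P.count₃ p q r := by
  simp [count₃, restrict, hp, hq, hr]

/-- A profile of four candidates whose restrictions to two and three candidates encode the
restrictions of a given antisymmetric matrix. -/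
theorem exists_encoding_restrict [Infinite 𝒱] (x : Fin 4 ↪ 𝒳) (M : Fin 4 → Fin 4 → ℤ)
    (hM : ∀ i j, M j i = -M i j) (hM6 : ∀ i j, |M i j| ≤ 6) :
    ∃ P : Profile 𝒳 𝒱, P.voters.Nonempty ∧ P.cands = Finset.univ.map x ∧
      (∀ i j, i ≠ j → P.margin (x i) (x j) = 12 * M i j) ∧
      (∀ i j (A : Finset 𝒳), i ≠ j → (∀ m, x m ∈ A ↔ m = i ∨ m = j) →
        (P.restrict A).IsPair (x i) (x j) (M i j)) ∧
      (∀ i j k (A : Finset 𝒳), [i, j, k].Nodup → (∀ m, x m ∈ A ↔ m = i ∨ m = j ∨ m = k) →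
        (P.restrict A).IsCycle (x i) (x j) (x k) (M i j) (M j k) (M k i)) := by
  obtain ⟨P, hP, h3, h2⟩ := exists_encoding (𝒱 := 𝒱) x M hM hM6
  have hv : P.voters.Nonempty := by
    have hpos : P.count₂ (x 0) (x 1) ≠ 0 := by
      have h := h2 0 1 (by decide)
      have := abs_le.1 (hM6 0 1)
      omega
    obtain ⟨i, hi⟩ := Set.nonempty_of_ncard_ne_zero hpos
    exact ⟨i, mem_voters_of_ballot hi⟩
  have hne : ∀ {i j}, i ≠ j → x i ≠ x j := fun h h' => h (x.injective h')
  refine ⟨P, hv, hP, ?_, ?_, ?_⟩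
  · intro i j hij
    rw [margin_eq, h2 i j hij, h2 j i hij.symm, hM i j]
    ring
  · intro i j A hij hA
    have hi := (hA i).2 (by simp)
    have hj := (hA j).2 (by simp)
    refine ⟨hv, hne hij, fun z => ?_, ?_, ?_⟩
    · simp only [restrict, hP, Finset.mem_inter, Finset.mem_map, Finset.mem_univ, true_and]
      constructor
      · rintro ⟨⟨m, rfl⟩, hm⟩
        simpa using (hA m).1 hm
      · rintro (rfl | rfl)
        exacts [⟨⟨_, rfl⟩, hi⟩, ⟨⟨_, rfl⟩, hj⟩]
    · rw [count₂_restrict _ hi hj, h2 i j hij]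
    · rw [count₂_restrict _ hj hi, h2 j i hij.symm, hM i j]
      ring
  · intro i j k A hnd hA
    have hi := (hA i).2 (by simp)
    have hj := (hA j).2 (by simp)
    have hk := (hA k).2 (by simp)
    have hnd' := hnd
    simp only [List.nodup_cons, List.mem_cons, List.not_mem_nil, or_false, not_or] at hnd'
    refine ⟨hv, hne hnd'.1.1, hne hnd'.2.1, (hne hnd'.1.2).symm, fun z => ?_, ?_, ?_, ?_, ?_, ?_, ?_⟩
    · simp only [restrict, hP, Finset.mem_inter, Finset.mem_map, Finset.mem_univ, true_and]
      constructor
      · rintro ⟨⟨m, rfl⟩, hm⟩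
        simpa using (hA m).1 hm
      · rintro (rfl | rfl | rfl)
        exacts [⟨⟨_, rfl⟩, hi⟩, ⟨⟨_, rfl⟩, hj⟩, ⟨⟨_, rfl⟩, hk⟩]
    all_goals rw [count₃_restrict P (by assumption) (by assumption) (by assumption), h3 _ _ _ (by
      simp only [List.nodup_cons, List.mem_cons, List.not_mem_nil, or_false, not_or]
      grind)]
    all_goals
      have := hM i j
      have := hM j k
      have := hM k i
      linarith

end DecidableEq

end Profile

/-! ### Verdicts as functions of the weights. -/

namespace VotingMethod

variable {𝒳 𝒱 : Type*} {F : VotingMethod 𝒳 𝒱} {P Q : Profile 𝒳 𝒱} {a b c : 𝒳} {u v w : ℤ}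

theorem DefinedUpToFour.pair_mem (hF : F.DefinedUpToFour) (h : P.IsPair a b u) : P ∈ F.dom :=
  hF P h.nonempty h.cands_nonempty h.card_le

theorem DefinedUpToFour.cycle_mem (hF : F.DefinedUpToFour) (h : P.IsCycle a b c u v w) :
    P ∈ F.dom :=
  hF P h.nonempty h.cands_nonempty h.card_le

/-- In some two-candidate profile of weight `u`, the candidate favoured by `u` is the winner. -/
def Beats (F : VotingMethod 𝒳 𝒱) (u : ℤ) : Prop :=
  ∃ P a b, P.IsPair a b u ∧ F.winners P = {a}

/-- In some cycle with weights `u`, `v`, `w`, the candidate opposite to `u` is a winner. -/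
def CycleWins (F : VotingMethod 𝒳 𝒱) (u v w : ℤ) : Prop :=
  ∃ P a b c, P.IsCycle a b c u v w ∧ c ∈ F.winners P

variable [DecidableEq 𝒳] [DecidableEq 𝒱]

/-- One instance decides all: transpositions move its candidates one at a time to the desired ones,
and anonymity identifies the resulting profile with `Q`. The argument for cycles is the same with
three transpositions. -/
theorem Beats.winners_eq (hF : F.DefinedUpToFour) (hA : F.Anonymity) (hN : F.Neutrality)
    (hu : F.Beats u) (hQ : Q.IsPair a b u) : F.winners Q = {a} := by
  have step : ∀ {a b} (x y : 𝒳), (∃ P, P.IsPair a b u ∧ F.winners P = {a}) →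
      ∃ P, P.IsPair (Equiv.swap x y a) (Equiv.swap x y b) u ∧
        F.winners P = {Equiv.swap x y a} := by
    rintro a b x y ⟨P, hP, hw⟩
    refine ⟨_, hP.swapCands x y, ?_⟩
    rw [hN _ (hF.pair_mem hP) x y (hF.pair_mem (hP.swapCands x y)), hw]
    simp
  obtain ⟨P, a', b', hP, hw⟩ := hu
  have h1 := step a' a ⟨P, hP, hw⟩
  rw [Equiv.swap_apply_left] at h1
  have hb : a ≠ Equiv.swap a' a b' := h1.choose_spec.1.ne
  have h2 := step (Equiv.swap a' a b') b h1
  rw [Equiv.swap_apply_left, Equiv.swap_apply_of_ne_of_ne hb hQ.ne] at h2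
  obtain ⟨P, hP, hw⟩ := h2
  rw [← hw]
  exact hA.winners_eq hF hQ.nonempty hQ.cands_nonempty hQ.card_le
    (by ext; rw [hP.mem_cands, hQ.mem_cands]) (hQ.ncard_ballot_eq hP)

theorem CycleWins.mem_winners (hF : F.DefinedUpToFour) (hA : F.Anonymity) (hN : F.Neutrality)
    (hu : F.CycleWins u v w) (hQ : Q.IsCycle a b c u v w) : c ∈ F.winners Q := by
  have step : ∀ {a b c} (x y : 𝒳), (∃ P, P.IsCycle a b c u v w ∧ c ∈ F.winners P) →
      ∃ P, P.IsCycle (Equiv.swap x y a) (Equiv.swap x y b) (Equiv.swap x y c) u v w ∧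
        Equiv.swap x y c ∈ F.winners P := by
    rintro a b c x y ⟨P, hP, hw⟩
    refine ⟨_, hP.swapCands x y, ?_⟩
    rw [hN _ (hF.cycle_mem hP) x y (hF.cycle_mem (hP.swapCands x y))]
    exact Finset.mem_map_of_mem _ hw
  obtain ⟨P, a', b', c', hP, hw⟩ := hu
  have h1 := step a' a ⟨P, hP, hw⟩
  rw [Equiv.swap_apply_left] at h1
  have hb : a ≠ Equiv.swap a' a b' := h1.choose_spec.1.ne_ab
  have h2 := step (Equiv.swap a' a b') b h1
  rw [Equiv.swap_apply_left, Equiv.swap_apply_of_ne_of_ne hb hQ.ne_ab] at h2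
  generalize Equiv.swap (Equiv.swap a' a b') b (Equiv.swap a' a c') = c'' at h2
  have hca := h2.choose_spec.1.ne_ca
  have hcb := h2.choose_spec.1.ne_bc
  have h3 := step c'' c h2
  rw [Equiv.swap_apply_left, Equiv.swap_apply_of_ne_of_ne hca.symm hQ.ne_ca.symm,
    Equiv.swap_apply_of_ne_of_ne hcb hQ.ne_bc] at h3
  obtain ⟨P, hP, hw⟩ := h3
  rwa [hA.winners_eq hF hQ.nonempty hQ.cands_nonempty hQ.card_le
    (by ext; rw [hP.mem_cands, hQ.mem_cands]) (hQ.ncard_ballot_eq hP)]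

end VotingMethod

/-! ### The four-candidate tournament and the conflict it creates. -/

/-- The edge labels of the tournament `0 → 1`, `0 → 2`, `3 → 0`, `1 → 2`, `1 → 3`, `2 → 3`. -/
def edgeLabel : Fin 4 → Fin 4 → Fin 6 :=
  -- The diagonal zeros are placeholders, since `edgeSign` vanishes there.
  ![![0, 0, 1, 2], ![0, 0, 3, 4], ![1, 3, 0, 5], ![2, 4, 5, 0]]

/-- The edge directions of the tournament `0 → 1`, `0 → 2`, `3 → 0`, `1 → 2`, `1 → 3`, `2 → 3`. -/
def edgeSign : Fin 4 → Fin 4 → ℤ :=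
  ![![0, 1, 1, -1], ![-1, 0, 1, 1], ![-1, -1, 0, 1], ![1, -1, -1, 0]]

/-- The antisymmetric matrix of the tournament `0 → 1`, `0 → 2`, `3 → 0`, `1 → 2`, `1 → 3`, `2 → 3`
with the weights `T`. -/
def weightMatrix (T : Fin 6 → ℤ) (i j : Fin 4) : ℤ := edgeSign i j * T (edgeLabel i j)

theorem weightMatrix_antisymm (T : Fin 6 → ℤ) (i j : Fin 4) :
    weightMatrix T j i = -weightMatrix T i j := by
  have h1 : ∀ i j, edgeSign j i = -edgeSign i j := by decide
  have h2 : ∀ i j, edgeLabel j i = edgeLabel i j := by decide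
  rw [weightMatrix, weightMatrix, h1 i j, h2 i j, neg_mul]

theorem abs_weightMatrix_le {T : Fin 6 → ℤ} {B : ℤ} (hT : ∀ e, |T e| ≤ B) (i j : Fin 4) :
    |weightMatrix T i j| ≤ B := by
  have h1 : ∀ i j, |edgeSign i j| ≤ 1 := by decide
  rw [weightMatrix, abs_mul]
  exact (mul_le_of_le_one_left (abs_nonneg _) (h1 i j)).trans (hT _)

/-- Edges with different labels differ in absolute value; the two directions of one edge carry
opposite nonzero weights. -/
theorem weightMatrix_ne {T : Fin 6 → ℤ} (hT : Function.Injective fun e => |T e|)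
    (hT0 : ∀ e, T e ≠ 0) {i j k l : Fin 4} (hij : i ≠ j) (hkl : k ≠ l) (hne : (i, j) ≠ (k, l)) :
    weightMatrix T i j ≠ weightMatrix T k l := by
  intro h
  have hs : ∀ i j, i ≠ j → |edgeSign i j| = 1 := by decide
  have hl : ∀ i j k l, i ≠ j → k ≠ l → (i, j) ≠ (k, l) → edgeLabel i j = edgeLabel k l →
      k = j ∧ l = i := by decide
  have habs := congrArg abs h
  rw [weightMatrix, weightMatrix, abs_mul, abs_mul, hs i j hij, hs k l hkl, one_mul, one_mul]
    at habs
  obtain ⟨rfl, rfl⟩ := hl i j k l hij hkl hne (hT habs)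
  rw [weightMatrix_antisymm T l k] at h
  have h0 : weightMatrix T l k = 0 := by omega
  rw [weightMatrix, mul_eq_zero] at h0
  rcases h0 with h0 | h0
  · have := hs l k hij
    simp [h0] at this
  · exact hT0 _ h0

namespace VotingMethod

variable {𝒳 𝒱 : Type*} {F : VotingMethod 𝒳 𝒱} [DecidableEq 𝒳]

/-- If the second candidate is the unique winner, reading the pair backwards turns `u` into `-u`. -/
theorem beats_or_beats_neg [Infinite 𝒳] [Infinite 𝒱] (hF : F.DefinedUpToFour)
    (hQ : F.QuasiResoluteness) {u : ℤ} (hu : |u| ≤ 6) (hu0 : u ≠ 0) :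
    F.Beats u ∨ F.Beats (-u) := by
  let x : Fin 4 ↪ 𝒳 := Fin.valEmbedding.trans (Infinite.natEmbedding 𝒳)
  obtain ⟨P, -, -, -, h2, -⟩ := Profile.exists_encoding_restrict (𝒱 := 𝒱) x
    (weightMatrix fun _ => u) (weightMatrix_antisymm _) (abs_weightMatrix_le fun _ => hu)
  have h : (P.restrict {x 0, x 1}).IsPair (x 0) (x 1) u := by
    have := h2 0 1 {x 0, x 1} (by decide) (by simp)
    rwa [show weightMatrix (fun _ => u) 0 1 = u from one_mul u] at this
  have hd := hF.pair_mem h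
  obtain ⟨y, hy⟩ := Finset.card_eq_one.1 (hQ _ hd (h.uniquelyWeighted hu0))
  have hyc := F.winners_subset _ hd (hy ▸ Finset.mem_singleton_self y)
  rcases (h.mem_cands y).1 hyc with rfl | rfl
  · exact Or.inl ⟨_, _, _, h, hy⟩
  · exact Or.inr ⟨_, _, _, h.symm, hy⟩

theorem exists_cycleWins [Infinite 𝒳] [Infinite 𝒱] (hF : F.DefinedUpToFour) {u v w : ℤ}
    (hu : |u| ≤ 6) (hv : |v| ≤ 6) (hw : |w| ≤ 6) :
    F.CycleWins u v w ∨ F.CycleWins v w u ∨ F.CycleWins w u v := by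
  let x : Fin 4 ↪ 𝒳 := Fin.valEmbedding.trans (Infinite.natEmbedding 𝒳)
  obtain ⟨P, -, -, -, -, h3⟩ := Profile.exists_encoding_restrict (𝒱 := 𝒱) x
    -- The cycle 0 → 1 → 3 → 0 has labels 0, 4, 2; the other edges do not affect the restriction.
    (weightMatrix ![u, 0, w, 0, v, 0]) (weightMatrix_antisymm _)
    (abs_weightMatrix_le fun e => by fin_cases e <;> simp [hu, hv, hw])
  have h : (P.restrict {x 0, x 1, x 3}).IsCycle (x 0) (x 1) (x 3) u v w := by
    have := h3 0 1 3 {x 0, x 1, x 3} (by decide) (by simp)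
    simpa [weightMatrix, edgeSign, edgeLabel] using this
  have hd := hF.cycle_mem h
  obtain ⟨y, hy⟩ := F.winners_nonempty _ hd
  rcases (h.mem_cands y).1 (F.winners_subset _ hd hy) with rfl | rfl | rfl
  · exact Or.inr (Or.inl ⟨_, _, _, _, h.rotate, hy⟩)
  · exact Or.inr (Or.inr ⟨_, _, _, _, h.rotate.rotate, hy⟩)
  · exact Or.inl ⟨_, _, _, _, h, hy⟩

/-- Without 1, the cycle 2 → 3 → 0 → 2 would be won by 0, which beats 1; without 2, the cycle 3 → 0
→ 1 → 3 would be won by 1, which beats 2. Binary `γ` would make both 0 and 1 win the uniquely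
weighted profile. -/
theorem not_cycleWins_of_cycleWins [DecidableEq 𝒱] [Infinite 𝒳] [Infinite 𝒱]
    (hF : F.DefinedUpToFour) (hA : F.Anonymity) (hN : F.Neutrality) (hG : F.BinaryGamma)
    (hQ : F.QuasiResoluteness) {T : Fin 6 → ℤ} (hT : Function.Injective fun e => |T e|)
    (hT0 : ∀ e, T e ≠ 0) (hT6 : ∀ e, |T e| ≤ 6) (hB : ∀ e, F.Beats (T e)) (h₁ : F.CycleWins (T 5) (T 2) (T 1)) :
    ¬ F.CycleWins (T 2) (T 0) (T 4) := by
  intro h₂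
  let x : Fin 4 ↪ 𝒳 := Fin.valEmbedding.trans (Infinite.natEmbedding 𝒳)
  obtain ⟨P, hv, hc, hm, h2, h3⟩ := Profile.exists_encoding_restrict (𝒱 := 𝒱) x
    (weightMatrix T) (weightMatrix_antisymm _) (abs_weightMatrix_le hT6)
  have hx : ∀ i, x i ∈ P.cands := by simp [hc]
  have hd : P ∈ F.dom := hF P hv ⟨_, hx 0⟩ (by simp [hc])
  have hP : P.UniquelyWeighted := by
    intro a ha b hb y hy z hz hab hyz hne
    rw [hc] at ha hb hy hz
    obtain ⟨i, -, rfl⟩ := Finset.mem_map.1 ha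
    obtain ⟨j, -, rfl⟩ := Finset.mem_map.1 hb
    obtain ⟨k, -, rfl⟩ := Finset.mem_map.1 hy
    obtain ⟨l, -, rfl⟩ := Finset.mem_map.1 hz
    have hij : i ≠ j := fun h => hab (h ▸ rfl)
    have hkl : k ≠ l := fun h => hyz (h ▸ rfl)
    have := weightMatrix_ne hT hT0 hij hkl fun h => hne (by
      obtain ⟨rfl, rfl⟩ := Prod.mk.inj h
      rfl)
    rw [hm i j hij, hm k l hkl]
    omega
  have hmem : ∀ l m, x m ∈ P.cands.erase (x l) ↔ m ≠ l := by simp [hc]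
  have c₁ : (P.remove (x 1)).IsCycle (x 2) (x 3) (x 0) (T 5) (T 2) (T 1) := by
    have := h3 2 3 0 (P.cands.erase (x 1)) (by decide) fun m => (hmem 1 m).trans (by
      revert m
      decide)
    simpa [Profile.remove, weightMatrix, edgeSign, edgeLabel] using this
  have c₂ : (P.remove (x 2)).IsCycle (x 3) (x 0) (x 1) (T 2) (T 0) (T 4) := by
    have := h3 3 0 1 (P.cands.erase (x 2)) (by decide) fun m => (hmem 2 m).trans (by
      revert m
      decide)
    simpa [Profile.remove, weightMatrix, edgeSign, edgeLabel] using this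
  have p₁ : (P.restrict {x 0, x 1}).IsPair (x 0) (x 1) (T 0) := by
    have := h2 0 1 {x 0, x 1} (by decide) (by simp)
    simpa [weightMatrix, edgeSign, edgeLabel] using this
  have p₂ : (P.restrict {x 1, x 2}).IsPair (x 1) (x 2) (T 3) := by
    have := h2 1 2 {x 1, x 2} (by decide) (by simp)
    simpa [weightMatrix, edgeSign, edgeLabel] using this
  have w₁ : x 0 ∈ F.winners P := hG P hd _ (hx 0) _ (hx 1) (hF.cycle_mem c₁) (hF.pair_mem p₁)
    (h₁.mem_winners hF hA hN c₁) ((hB 0).winners_eq hF hA hN p₁)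
  have w₂ : x 1 ∈ F.winners P := hG P hd _ (hx 1) _ (hx 2) (hF.cycle_mem c₂) (hF.pair_mem p₂)
    (h₂.mem_winners hF hA hN c₂) ((hB 3).winners_eq hF hA hN p₂)
  have := x.injective (Finset.card_le_one.1 (hQ P hd hP).le _ w₁ _ w₂)
  exact absurd this (by decide)

end VotingMethod

end Voting

/-! ### Assembling the contradiction. -/

theorem mainTheorem2 (𝒳 𝒱 : Type*) [Infinite 𝒳] [Infinite 𝒱] [DecidableEq 𝒳] [DecidableEq 𝒱] :
    ¬ ∃ F : Voting.VotingMethod 𝒳 𝒱,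
      (∀ P : Voting.Profile 𝒳 𝒱, P.voters.Nonempty → P.cands.Nonempty → P.cands.card ≤ 4 →
        P ∈ F.dom) ∧
      F.Anonymity ∧ F.Neutrality ∧ F.BinaryGamma ∧ F.QuasiResoluteness := by
  rintro ⟨F, hF, hA, hN, hG, hQ⟩
  have hex : ∀ i : Fin 6, ∃ u : ℤ, |u| = (i : ℕ) + 1 ∧ F.Beats u := by
    intro i
    have habs : |((i : ℕ) + 1 : ℤ)| = (i : ℕ) + 1 := abs_of_pos (by positivity)
    rcases Voting.VotingMethod.beats_or_beats_neg (F := F) hF hQ (u := (i : ℕ) + 1)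
      (by rw [habs]; omega) (by positivity) with h | h
    · exact ⟨_, habs, h⟩
    · exact ⟨_, by rw [abs_neg, habs], h⟩
  choose t ht hB using hex
  have ht6 : ∀ i, |t i| ≤ 6 := fun i => by rw [ht]; omega
  refine Voting.no_cyclic_choice (fun i j k => F.CycleWins (t i) (t j) (t k))
    (fun i j k _ => Voting.VotingMethod.exists_cycleWins hF (ht6 i) (ht6 j) (ht6 k)) ?_
  intro r p q s t' o hnd
  -- The order makes the triple of labels 5, 2, 1 equal to `r, p, q` and that of 2, 0, 4 equal to
  -- `p, s, t'`; `o` takes the remaining edge 1 → 2.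
  have hinj : Function.Injective ![s, q, p, o, t', r] := by
    rw [← List.nodup_ofFn]
    simp only [List.ofFn_succ, List.ofFn_zero, List.nodup_cons, List.mem_cons, List.not_mem_nil,
      Matrix.cons_val_zero, Matrix.cons_val_succ, or_false, not_or] at hnd ⊢
    grind
  refine Voting.VotingMethod.not_cycleWins_of_cycleWins hF hA hN hG hQ
    (T := fun e => t (![s, q, p, o, t', r] e)) ?_ ?_ (fun e => ht6 _) (fun e => hB _)
  · intro e e' h
    simp only [ht] at h
    exact hinj (Fin.ext (by omega))
  · intro e h
    have := ht (![s, q, p, o, t', r] e)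
    rw [h, abs_zero] at this
    omega
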